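/- Let $\mathbb{H}=\{(z,x_2,x_3)\in\mathbb{R}^3 : z>0\}$ be the upper half-space model of hyperbolic 3-space, with metric $h=(dz^2+dx_2^2+dx_3^2)/z^2$ and Laplacian $\Delta_h u=-z^2(\partial_z^2u+\partial_{x_2}^2u+\partial_{x_3}^2u)+z\,\partial_z u$. Let $S(\infty)$ be its sphere at infinity, i.e. the boundary sphere of the Poincaré ball model with its standard smooth structure; in the half-space model it is the boundary plane $\{z=0\}$ together with one point $\infty$. Let $\beta:S(\infty)\to\mathbb{R}$ be smooth and nowhere vanishing, and let $u_\beta:\mathbb{H}\to\mathbb{R}$ be the solution of the Dirichlet problem $$\Delta_h u_\beta=0 \text{ in } \mathbb{H},\qquad u_\beta|_{S(\infty)}=\beta^{-1},$$ that is, $u_\beta$ is of class $C^2$ on $\mathbb{H}$, satisfies $\Delta_h u_\beta=0$, and $u_\beta(q)\to\beta(\zeta)^{-1}$ as $q\in\mathbb{H}$ tends to $\zeta$, for every $\zeta\in S(\infty)$ (including $\infty$). Then there are $\epsilon>0$ and a smooth bounded function $v$ on $T_\epsilon=\{q\in\mathbb{H} : z(q)\le\epsilon\}$ such that $$u_\beta(z,x_2,x_3)=\beta(x_2,x_3)^{-1}+z\,v(z,x_2,x_3)\quad\text{for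 all }(z,x_2,x_3)\in T_\epsilon,$$ where $\beta(x_2,x_3)$ is the value of $\beta$ at the point $(0,x_2,x_3)$ of the boundary plane. -/

import Mathlib

open scoped Manifold ContDiff Topology
open Filter

/-- Euclidean three-space, with coordinates `(z, x₂, x₃)` at the indices `0, 1, 2`. -/
abbrev E3 : Type := EuclideanSpace ℝ (Fin 3)

/-- The upper half-space model of hyperbolic 3-space: the points with `z > 0`.
It carries the metric `(dz² + dx₂² + dx₃²) / z²`. -/
def hyperbolicSpace : Set E3 := {p | 0 < p 0}

/-- The (nonnegative) Laplace operator of the metric `(dz² + dx₂² + dx₃²) / z²`: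
`Δ_h u = - z² (∂_z² u + ∂_{x₂}² u + ∂_{x₃}² u) + z ∂_z u`.
`Laplacian.laplacian` is the Euclidean Laplacian, the sum of the second partial derivatives. -/
noncomputable def hyperbolicLaplacian (u : E3 → ℝ) (p : E3) : ℝ :=
  -(p 0) ^ 2 * Laplacian.laplacian u p + p 0 * fderiv ℝ u p (EuclideanSpace.single 0 1)

/-- `u` is a classical solution of `Δ_h u = 0` on hyperbolic space. -/
def IsHyperbolicHarmonic (u : E3 → ℝ) : Prop :=
  ContDiffOn ℝ 2 u hyperbolicSpace ∧ ∀ p ∈ hyperbolicSpace, hyperbolicLaplacian u p = 0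

/-- The isometry from the upper half-space model to the Poincaré ball model that takes
`(1, 0, 0)` to the centre. The formula also covers the boundary plane `z = 0`. -/
noncomputable def toBall (p : E3) : E3 :=
  !₂[((p 0) ^ 2 + (p 1) ^ 2 + (p 2) ^ 2 - 1) / ((p 0 + 1) ^ 2 + (p 1) ^ 2 + (p 2) ^ 2),
     2 * p 1 / ((p 0 + 1) ^ 2 + (p 1) ^ 2 + (p 2) ^ 2),
     2 * p 2 / ((p 0 + 1) ^ 2 + (p 1) ^ 2 + (p 2) ^ 2)]

/-- The sphere at infinity: the boundary of the ball model, with its standard smooth structure.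
Its points are the directions of the geodesic rays that emanate from the centre. -/
abbrev SphereAtInfinity : Type := Metric.sphere (0 : E3) 1

theorem norm_toBall_of_z_eq_zero (p : E3) (hp : p 0 = 0) : ‖toBall p‖ = 1 := by
  have hpos : 0 < 1 + (p 1) ^ 2 + (p 2) ^ 2 := by positivity
  have h : ‖toBall p‖ ^ 2 = 1 := by
    rw [EuclideanSpace.norm_sq_eq, Fin.sum_univ_three]
    simp only [toBall, hp, Real.norm_eq_abs, sq_abs]
    simp
    field_simp
    ring
  have h0 := norm_nonneg (toBall p)
  nlinarith

/-- The point of the sphere at infinity that corresponds to the point `(0, x₂, x₃)` of the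
boundary plane, i.e. the end point of the geodesic that runs down the vertical line over
`(x₂, x₃)`. The one remaining point of the sphere is `(1, 0, 0)`, the point `∞`. -/
noncomputable def boundaryPoint (x₂ x₃ : ℝ) : SphereAtInfinity :=
  ⟨toBall !₂[0, x₂, x₃], by simpa using norm_toBall_of_z_eq_zero !₂[0, x₂, x₃] (by simp)⟩

/-- `u` has the boundary values `f` on the whole sphere at infinity: `u q → f ζ` whenever the
point `q` of hyperbolic space tends to `ζ` in the closed ball. -/
def HasBoundaryValues (u : E3 → ℝ) (f : SphereAtInfinity → ℝ) : Prop :=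
  ∀ ζ : SphereAtInfinity,
    Tendsto u (comap toBall (𝓝 (ζ : E3)) ⊓ 𝓟 hyperbolicSpace) (𝓝 (f ζ))

/-- `T_ε = {q ∈ ℍ | z(q) ≤ ε}`. -/
def collar (ε : ℝ) : Set E3 := {p | p ∈ hyperbolicSpace ∧ p 0 ≤ ε}

/-! The function `u` is the normalised Poisson integral of its values `f` on the boundary plane.
Substituting `y = x + z s` turns that integral into an average of `f (x + z s)` against the fixed
weight `(1 + |s|²)⁻²`. Since `β⁻¹` is Lipschitz on the sphere, `f` is Lipschitz on the plane, and
since the weight has a finite first moment, `|u - f| ≤ C z`. So `v = (u - f) / z` is bounded; it is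
smooth because `u` and `f` are and `z > 0` (`abs_poissonIntegral_sub_le`).

The identification with the Poisson integral (`eqOn_poissonIntegral`) rests on a maximum principle
in which `∞` is an exceptional point: mere boundedness there suffices, thanks to the barrier `log
D`, with `D` the denominator of `toBall`. Smoothness and harmonicity of the Poisson integral come
from differentiation under the integral sign. The bounds for this come from compactness, once the
kernel is rewritten as a weight times a function of `p` and a point of the sphere at infinity. -/

/-! ### The Laplacian: local maxima, linearity, computation along the axes. -/

theorem isOpen_hyperbolicSpace : IsOpen hyperbolicSpace :=
  isOpen_lt continuous_const (by fun_prop)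

theorem laplacian_eq_sum_fderiv {u : E3 → ℝ} {p : E3} (hu : ContDiffAt ℝ 2 u p) :
    Laplacian.laplacian u p = ∑ i : Fin 3, fderiv ℝ
      (fun q => fderiv ℝ u q (EuclideanSpace.single i 1)) p (EuclideanSpace.single i 1) := by
  have hd : DifferentiableAt ℝ (fderiv ℝ u) p :=
    (hu.fderiv_right (m := 1) (by norm_num)).differentiableAt (by norm_num)
  rw [InnerProductSpace.laplacian_eq_iteratedFDeriv_orthonormalBasis u
    (EuclideanSpace.basisFun (Fin 3) ℝ)]
  refine Finset.sum_congr rfl fun i _ => ?_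
  rw [iteratedFDeriv_two_apply, fderiv_clm_apply hd (by fun_prop)]
  simp

/-- Restrict to a line. A positive second derivative would make the maximum a local minimum as well,
so `u` would be locally constant on the line and the second derivative would vanish. -/
theorem fderiv_fderiv_nonpos_of_isLocalMax {u : E3 → ℝ} {p : E3} (hu : ContDiffAt ℝ 2 u p)
    (hmax : IsLocalMax u p) (v : E3) : fderiv ℝ (fun q => fderiv ℝ u q v) p v ≤ 0 := by
  by_contra! hpos
  have hd : DifferentiableAt ℝ (fderiv ℝ u) p :=
    (hu.fderiv_right (m := 1) (by norm_num)).differentiableAt (by norm_num)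
  have hline (t : ℝ) : HasDerivAt (fun t : ℝ => p + t • v) v t := by
    simpa using ((hasDerivAt_id t).smul_const v).const_add p
  have hcont : Tendsto (fun t : ℝ => p + t • v) (𝓝 0) (𝓝 p) := by
    simpa using (hline 0).continuousAt.tendsto
  have hderiv : ∀ᶠ t in 𝓝 (0 : ℝ),
      HasDerivAt (fun t : ℝ => u (p + t • v)) (fderiv ℝ u (p + t • v) v) t := by
    filter_upwards [hcont.eventually (hu.eventually (by norm_num))] with t ht
    exact (ht.differentiableAt (by norm_num)).hasFDerivAt.comp_hasDerivAt t (hline t)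
  have hderiv2 : HasDerivAt (deriv fun t : ℝ => u (p + t • v))
      (fderiv ℝ (fun q => fderiv ℝ u q v) p v) 0 := by
    have h1 : DifferentiableAt ℝ (fun q => fderiv ℝ u q v) p := by fun_prop
    have h2 := h1.hasFDerivAt
    rw [show p = p + (0 : ℝ) • v by simp] at h2
    have h3 := h2.comp_hasDerivAt (0 : ℝ) (hline 0)
    simp only [zero_smul, add_zero] at h3
    refine h3.congr_of_eventuallyEq ?_
    filter_upwards [hderiv] with t ht
    exact ht.deriv
  have hmax' : IsLocalMax (fun t : ℝ => u (p + t • v)) 0 := by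
    have := hcont.eventually hmax
    filter_upwards [this] with t ht
    simpa using ht
  have hmin : IsLocalMin (fun t : ℝ => u (p + t • v)) 0 :=
    isLocalMin_of_deriv_deriv_pos (by rw [hderiv2.deriv]; exact hpos) hmax'.deriv_eq_zero
      hderiv.self_of_nhds.continuousAt
  have hconst : (fun t : ℝ => u (p + t • v)) =ᶠ[𝓝 0] fun _ => u (p + (0 : ℝ) • v) := by
    filter_upwards [hmax', hmin] with t h1 h2 using le_antisymm h1 h2
  have := hconst.deriv.deriv_eq
  rw [hderiv2.deriv] at this
  simp at this
  exact hpos.ne' this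

theorem hyperbolicLaplacian_nonneg_of_isLocalMax {u : E3 → ℝ} {p : E3} (hu : ContDiffAt ℝ 2 u p)
    (hmax : IsLocalMax u p) : 0 ≤ hyperbolicLaplacian u p := by
  rw [hyperbolicLaplacian, laplacian_eq_sum_fderiv hu, hmax.fderiv_eq_zero]
  have := Finset.sum_nonpos fun (i : Fin 3) (_ : i ∈ Finset.univ) =>
    fderiv_fderiv_nonpos_of_isLocalMax hu hmax (EuclideanSpace.single i 1)
  simp only [zero_apply, mul_zero, add_zero]
  nlinarith [sq_nonneg (p 0)]

theorem hyperbolicLaplacian_sub {u v : E3 → ℝ} {p : E3} (hu : ContDiffAt ℝ 2 u p)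
    (hv : ContDiffAt ℝ 2 v p) : hyperbolicLaplacian (fun q => u q - v q) p =
      hyperbolicLaplacian u p - hyperbolicLaplacian v p := by
  have h1 := hu.laplacian_sub hv
  have h2 := fderiv_fun_sub (hu.differentiableAt (by norm_num)) (hv.differentiableAt (by norm_num))
  simp only [hyperbolicLaplacian, h2]
  rw [show (fun q => u q - v q) = u - v from rfl, h1]
  simp
  ring

theorem hyperbolicLaplacian_const_mul {u : E3 → ℝ} {p : E3} (c : ℝ) (hu : ContDiffAt ℝ 2 u p) :
    hyperbolicLaplacian (fun q => c * u q) p = c * hyperbolicLaplacian u p := by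
  have h1 := InnerProductSpace.laplacian_smul c hu
  have h2 := fderiv_const_mul (hu.differentiableAt (by norm_num)) c
  simp only [hyperbolicLaplacian, h2]
  rw [show (fun q => c * u q) = c • u from rfl, h1]
  simp
  ring

/-- The hyperbolic Laplacian from first and second partial derivatives along the axes. -/
theorem hyperbolicLaplacian_eq_of_hasLineDerivAt {u : E3 → ℝ} {p : E3} (hu : ContDiffAt ℝ 2 u p)
    {u' : Fin 3 → E3 → ℝ} {u'' : Fin 3 → ℝ}
    (h1 : ∀ i, ∀ᶠ q in 𝓝 p, HasLineDerivAt ℝ u (u' i q) q (EuclideanSpace.single i 1))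
    (h2 : ∀ i, HasLineDerivAt ℝ (u' i) (u'' i) p (EuclideanSpace.single i 1)) :
    hyperbolicLaplacian u p = -(p 0) ^ 2 * (u'' 0 + u'' 1 + u'' 2) + p 0 * u' 0 p := by
  have hd : DifferentiableAt ℝ (fderiv ℝ u) p :=
    (hu.fderiv_right (m := 1) (by norm_num)).differentiableAt (by norm_num)
  have key (i : Fin 3) : (fun q => fderiv ℝ u q (EuclideanSpace.single i 1)) =ᶠ[𝓝 p] u' i := by
    filter_upwards [h1 i, hu.eventually (by norm_num)] with q hq hq'
    exact ((hq'.differentiableAt (by norm_num)).hasFDerivAt.hasLineDerivAt _).unique hq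
  have key2 (i : Fin 3) : fderiv ℝ (fun q => fderiv ℝ u q (EuclideanSpace.single i 1)) p
      (EuclideanSpace.single i 1) = u'' i := by
    have h : DifferentiableAt ℝ (fun q => fderiv ℝ u q (EuclideanSpace.single i (1 : ℝ))) p := by
      fun_prop
    have h' := (h.congr_of_eventuallyEq (key i).symm).hasFDerivAt.hasLineDerivAt
      (EuclideanSpace.single i 1)
    rw [(key i).fderiv_eq]
    exact h'.unique (h2 i)
  rw [hyperbolicLaplacian, laplacian_eq_sum_fderiv hu, Fin.sum_univ_three, key2, key2, key2,
    ← (key 0).self_of_nhds]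

/-! ### A barrier at infinity. -/

/-- The denominator of the isometry to the ball model. -/
noncomputable def ballDenom (p : E3) : ℝ := (p 0 + 1) ^ 2 + (p 1) ^ 2 + (p 2) ^ 2

theorem one_lt_ballDenom {p : E3} (hp : p ∈ hyperbolicSpace) : 1 < ballDenom p := by
  have : 0 < p 0 := hp
  unfold ballDenom
  nlinarith [sq_nonneg (p 1), sq_nonneg (p 2)]

theorem contDiff_ballDenom {n : ℕ∞ω} : ContDiff ℝ n ballDenom := by
  unfold ballDenom
  fun_prop

theorem contDiffAt_log_ballDenom {p : E3} (hp : p ∈ hyperbolicSpace) :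
    ContDiffAt ℝ 2 (fun q => Real.log (ballDenom q)) p :=
  contDiff_ballDenom.contDiffAt.log (by linarith [one_lt_ballDenom hp])

theorem hasDerivAt_coord_line (q v : E3) (j : Fin 3) (t : ℝ) :
    HasDerivAt (fun t : ℝ => (q + t • v) j) (v j) t := by
  simpa using ((hasDerivAt_id t).mul_const (v j)).const_add (q j)

theorem hasDerivAt_ballDenom_line (q v : E3) :
    HasDerivAt (fun t : ℝ => ballDenom (q + t • v))
      (2 * ((q 0 + 1) * v 0 + q 1 * v 1 + q 2 * v 2)) 0 := by
  have h := ((((hasDerivAt_coord_line q v 0 0).add_const 1).pow 2).add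
    ((hasDerivAt_coord_line q v 1 0).pow 2)).add ((hasDerivAt_coord_line q v 2 0).pow 2)
  refine h.congr_deriv ?_
  simp
  ring

/-- The value is `2 z / D`. In the present sign convention `log D` is therefore strictly
superharmonic; it is also positive and tends to infinity at `∞`, which makes it a barrier there. -/
theorem hyperbolicLaplacian_log_ballDenom_pos {p : E3} (hp : p ∈ hyperbolicSpace) :
    0 < hyperbolicLaplacian (fun q => Real.log (ballDenom q)) p := by
  have hz : 0 < p 0 := hp
  have hD := one_lt_ballDenom hp
  let e (i : Fin 3) : E3 := EuclideanSpace.single i 1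
  let g (v q : E3) : ℝ := 2 * ((q 0 + 1) * v 0 + q 1 * v 1 + q 2 * v 2)
  rw [hyperbolicLaplacian_eq_of_hasLineDerivAt (contDiffAt_log_ballDenom hp)
    (u' := fun i q => g (e i) q / ballDenom q)
    (u'' := fun i => (2 * ((e i 0) ^ 2 + (e i 1) ^ 2 + (e i 2) ^ 2) * ballDenom p -
      g (e i) p ^ 2) / ballDenom p ^ 2)]
  · have h : -(p 0) ^ 2 * ((2 * ballDenom p - (2 * (p 0 + 1)) ^ 2) / ballDenom p ^ 2 +
        (2 * ballDenom p - (2 * p 1) ^ 2) / ballDenom p ^ 2 +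
        (2 * ballDenom p - (2 * p 2) ^ 2) / ballDenom p ^ 2) +
        p 0 * (2 * (p 0 + 1) / ballDenom p) = 2 * p 0 / ballDenom p := by
      field_simp
      unfold ballDenom
      ring
    have h0 : 0 < 2 * p 0 / ballDenom p := by positivity
    simp [g, e]
    linarith
  · intro i
    filter_upwards [isOpen_hyperbolicSpace.mem_nhds hp] with q hq
    have hq' := one_lt_ballDenom hq
    have h := (hasDerivAt_ballDenom_line q (e i)).log (by simp; linarith)
    exact h.congr_deriv (by simp [g])
  · intro i
    have hg : HasDerivAt (fun t : ℝ => g (e i) (p + t • e i))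
        (2 * ((e i 0) ^ 2 + (e i 1) ^ 2 + (e i 2) ^ 2)) 0 := by
      have h := (((((hasDerivAt_coord_line p (e i) 0 0).add_const 1).mul_const (e i 0)).add
        ((hasDerivAt_coord_line p (e i) 1 0).mul_const (e i 1))).add
        ((hasDerivAt_coord_line p (e i) 2 0).mul_const (e i 2))).const_mul 2
      exact h.congr_deriv (by ring)
    have h := hg.div (hasDerivAt_ballDenom_line p (e i)) (by simp; linarith)
    refine h.congr_deriv ?_
    simp only [zero_smul, add_zero, g]
    ring

/-! ### Harmonicity of the Poisson kernel. -/

/-- Up to normalisation, the Poisson kernel of the upper half-space model. -/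
noncomputable def hyperbolicPoissonKernel (y : EuclideanSpace ℝ (Fin 2)) (p : E3) : ℝ :=
  (p 0) ^ 2 / ((p 0) ^ 2 + (p 1 - y 0) ^ 2 + (p 2 - y 1) ^ 2) ^ 2

theorem contDiffAt_hyperbolicPoissonKernel (y : EuclideanSpace ℝ (Fin 2)) {p : E3}
    (hp : p ∈ hyperbolicSpace) : ContDiffAt ℝ 2 (hyperbolicPoissonKernel y) p := by
  have hz : 0 < p 0 := hp
  unfold hyperbolicPoissonKernel
  exact ContDiffAt.div (by fun_prop) (by fun_prop) (by positivity)

/-- Conceptually, `z²` is harmonic and the kernel is its pullback under the inversion centred at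
`y`, an isometry. The proof checks it directly from the partial derivatives. -/
theorem hyperbolicLaplacian_hyperbolicPoissonKernel (y : EuclideanSpace ℝ (Fin 2)) {p : E3}
    (hp : p ∈ hyperbolicSpace) : hyperbolicLaplacian (hyperbolicPoissonKernel y) p = 0 := by
  let e (i : Fin 3) : E3 := EuclideanSpace.single i 1
  let Q (q : E3) : ℝ := (q 0) ^ 2 + (q 1 - y 0) ^ 2 + (q 2 - y 1) ^ 2
  let g (v q : E3) : ℝ := 2 * (q 0 * v 0 + (q 1 - y 0) * v 1 + (q 2 - y 1) * v 2)
  have hQpos {q : E3} (hq : q ∈ hyperbolicSpace) : 0 < Q q := by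
    have : 0 < q 0 := hq
    positivity
  have hQ (q v : E3) : HasDerivAt (fun t : ℝ => Q (q + t • v)) (g v q) 0 := by
    have h := (((hasDerivAt_coord_line q v 0 0).pow 2).add
      (((hasDerivAt_coord_line q v 1 0).sub_const (y 0)).pow 2)).add
      (((hasDerivAt_coord_line q v 2 0).sub_const (y 1)).pow 2)
    refine h.congr_deriv ?_
    simp [g]
    ring
  have hg (q v : E3) : HasDerivAt (fun t : ℝ => g v (q + t • v))
      (2 * ((v 0) ^ 2 + (v 1) ^ 2 + (v 2) ^ 2)) 0 := by
    have h := ((((hasDerivAt_coord_line q v 0 0).mul_const (v 0)).add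
      (((hasDerivAt_coord_line q v 1 0).sub_const (y 0)).mul_const (v 1))).add
      (((hasDerivAt_coord_line q v 2 0).sub_const (y 1)).mul_const (v 2))).const_mul 2
    exact h.congr_deriv (by ring)
  rw [hyperbolicLaplacian_eq_of_hasLineDerivAt (contDiffAt_hyperbolicPoissonKernel y hp)
    (u' := fun i q => (2 * q 0 * e i 0 * Q q - 2 * (q 0) ^ 2 * g (e i) q) / Q q ^ 3)
    (u'' := fun i => ((2 * (e i 0) ^ 2 * Q p - 2 * p 0 * e i 0 * g (e i) p -
      4 * (p 0) ^ 2 * ((e i 0) ^ 2 + (e i 1) ^ 2 + (e i 2) ^ 2)) * Q p -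
      3 * (2 * p 0 * e i 0 * Q p - 2 * (p 0) ^ 2 * g (e i) p) * g (e i) p) / Q p ^ 4)]
  · have hQp := hQpos hp
    simp [g, e]
    field_simp
    simp only [Q]
    ring
  · intro i
    filter_upwards [isOpen_hyperbolicSpace.mem_nhds hp] with q hq
    have hq' := hQpos hq
    have h := ((hasDerivAt_coord_line q (e i) 0 0).pow 2).div ((hQ q (e i)).pow 2)
      (by simp; positivity)
    refine h.congr_deriv ?_
    simp only [zero_smul, add_zero, Pi.pow_apply]
    field_simp
    push_cast
    ring
  · intro i
    have hQp := hQpos hp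
    have h := ((((hasDerivAt_coord_line p (e i) 0 0).const_mul 2).mul_const (e i 0)).mul
      (hQ p (e i))).sub ((((hasDerivAt_coord_line p (e i) 0 0).pow 2).const_mul 2).mul (hg p (e i)))
    have h := h.div ((hQ p (e i)).pow 3) (by simp; positivity)
    refine h.congr_deriv ?_
    simp only [zero_smul, add_zero, Pi.pow_apply, Pi.mul_apply, Pi.sub_apply]
    field_simp
    push_cast
    ring

/-! ### Maximum principle and uniqueness. -/

/-- The maximum principle, with an exceptional point at infinity where the function only has to be
bounded above. -/
theorem nonpos_of_isHyperbolicHarmonic {w : E3 → ℝ} (hw : IsHyperbolicHarmonic w)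
    (hbd : ∀ p : E3, p 0 = 0 → Tendsto w (𝓝[hyperbolicSpace] p) (𝓝 0))
    {R M : ℝ} (hinf : ∀ p ∈ hyperbolicSpace, R ≤ ballDenom p → w p ≤ M)
    {p : E3} (hp : p ∈ hyperbolicSpace) : w p ≤ 0 := by
  have hcd {q : E3} (hq : q ∈ hyperbolicSpace) : ContDiffAt ℝ 2 w q :=
    hw.1.contDiffAt (isOpen_hyperbolicSpace.mem_nhds hq)
  have key (ε : ℝ) (hε : 0 < ε) : w p - ε * Real.log (ballDenom p) ≤ 0 := by
    by_contra! hpos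
    set g : E3 → ℝ := fun q => w q - ε * Real.log (ballDenom q) with hg
    have hgcd {q : E3} (hq : q ∈ hyperbolicSpace) : ContDiffAt ℝ 2 g q :=
      (hcd hq).sub (contDiffAt_const.mul (contDiffAt_log_ballDenom hq))
    -- This superlevel set is compact: the barrier bounds it, and the zero boundary values with `g p
    -- > 0` keep its limit points off the plane. So `g` attains a maximum, where its Laplacian is
    -- nonnegative, yet the barrier makes it negative.
    set S : Set E3 := {q | q ∈ hyperbolicSpace ∧ g p ≤ g q} with hS
    have hlog {q : E3} (hq : q ∈ hyperbolicSpace) : 0 < Real.log (ballDenom q) :=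
      Real.log_pos (one_lt_ballDenom hq)
    have hbdd : Bornology.IsBounded S := by
      rw [isBounded_iff_forall_norm_le]
      refine ⟨max R (Real.exp (M / ε)) + 1, fun q hq => ?_⟩
      have hD : ballDenom q ≤ max R (Real.exp (M / ε)) := by
        by_contra! hlt
        have h1 := hinf q hq.1 ((le_max_left _ _).trans hlt.le)
        have h2 : M / ε < Real.log (ballDenom q) :=
          (Real.lt_log_iff_exp_lt (by linarith [one_lt_ballDenom hq.1])).2
            ((le_max_right _ _).trans_lt hlt)
        rw [div_lt_iff₀ hε] at h2
        have h3 : g p ≤ w q - ε * Real.log (ballDenom q) := hq.2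
        linarith
      have h1 : ‖q‖ ^ 2 ≤ ballDenom q := by
        have : 0 < q 0 := hq.1
        rw [EuclideanSpace.norm_sq_eq, Fin.sum_univ_three]
        simp only [Real.norm_eq_abs, sq_abs, ballDenom]
        linarith
      nlinarith [sq_nonneg (‖q‖ - 1)]
    have hclosed : IsClosed S := by
      rw [← isSeqClosed_iff_isClosed]
      intro x q hx hxq
      have hq0 : 0 ≤ q 0 := by
        have h : Tendsto (fun n => x n 0) atTop (𝓝 (q 0)) :=
          ((by fun_prop : Continuous fun q : E3 => q 0).tendsto q).comp hxq
        exact ge_of_tendsto' h fun n => (hx n).1.le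
      have hwithin : Tendsto x atTop (𝓝[hyperbolicSpace] q) :=
        tendsto_nhdsWithin_iff.2 ⟨hxq, Eventually.of_forall fun n => (hx n).1⟩
      rcases hq0.eq_or_lt with h0 | h0
      · have h1 := (hbd q h0.symm).comp hwithin
        have h2 : g p ≤ 0 := by
          refine ge_of_tendsto' h1 fun n => ?_
          have h3 : g p ≤ w (x n) - ε * Real.log (ballDenom (x n)) := (hx n).2
          have := mul_pos hε (hlog (hx n).1)
          simp only [Function.comp_apply]
          linarith
        exact absurd hpos (not_lt.2 h2)
      · exact ⟨h0, ge_of_tendsto' ((hgcd h0).continuousAt.tendsto.comp hxq) fun n => (hx n).2⟩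
    obtain ⟨m, hm, hmax⟩ := (Metric.isCompact_of_isClosed_isBounded hclosed hbdd).exists_isMaxOn
      ⟨p, hp, le_rfl⟩ (f := g) fun q hq => (hgcd hq.1).continuousAt.continuousWithinAt
    have hloc : IsLocalMax g m := by
      filter_upwards [isOpen_hyperbolicSpace.mem_nhds hm.1] with q hq
      by_cases h : g p ≤ g q
      · exact hmax ⟨hq, h⟩
      · exact (not_le.1 h).le.trans hm.2
    have h1 := hyperbolicLaplacian_nonneg_of_isLocalMax (hgcd hm.1) hloc
    have hl := contDiffAt_log_ballDenom hm.1
    rw [hg, hyperbolicLaplacian_sub (hcd hm.1) (contDiffAt_const.mul hl),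
      hyperbolicLaplacian_const_mul ε hl, hw.2 m hm.1] at h1
    have := mul_pos hε (hyperbolicLaplacian_log_ballDenom_pos hm.1)
    linarith
  -- Remove the barrier by letting its coefficient tend to zero.
  have hlim : Tendsto (fun ε : ℝ => w p - ε * Real.log (ballDenom p)) (𝓝[>] 0) (𝓝 (w p)) := by
    have : Continuous fun ε : ℝ => w p - ε * Real.log (ballDenom p) := by fun_prop
    simpa using (this.tendsto 0).mono_left nhdsWithin_le_nhds
  exact le_of_tendsto hlim (eventually_mem_nhdsWithin.mono fun ε hε => key ε hε)

theorem IsHyperbolicHarmonic.sub {u v : E3 → ℝ} (hu : IsHyperbolicHarmonic u)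
    (hv : IsHyperbolicHarmonic v) : IsHyperbolicHarmonic fun q => u q - v q :=
  ⟨hu.1.sub hv.1, fun p hp => by
    rw [hyperbolicLaplacian_sub (hu.1.contDiffAt (isOpen_hyperbolicSpace.mem_nhds hp))
      (hv.1.contDiffAt (isOpen_hyperbolicSpace.mem_nhds hp)), hu.2 p hp, hv.2 p hp, sub_zero]⟩

theorem IsHyperbolicHarmonic.const_mul {u : E3 → ℝ} (c : ℝ) (hu : IsHyperbolicHarmonic u) :
    IsHyperbolicHarmonic fun q => c * u q :=
  ⟨contDiffOn_const.mul hu.1, fun p hp => by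
    rw [hyperbolicLaplacian_const_mul c (hu.1.contDiffAt (isOpen_hyperbolicSpace.mem_nhds hp)),
      hu.2 p hp, mul_zero]⟩

theorem eqOn_of_isHyperbolicHarmonic {u v : E3 → ℝ} (hu : IsHyperbolicHarmonic u)
    (hv : IsHyperbolicHarmonic v)
    (hbd : ∀ p : E3, p 0 = 0 → Tendsto (fun q => u q - v q) (𝓝[hyperbolicSpace] p) (𝓝 0))
    {R M : ℝ} (hinf : ∀ p ∈ hyperbolicSpace, R ≤ ballDenom p → |u p - v p| ≤ M) :
    Set.EqOn u v hyperbolicSpace := by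
  intro p hp
  have h1 := nonpos_of_isHyperbolicHarmonic (hu.sub hv) hbd
    (fun q hq hR => (le_abs_self _).trans (hinf q hq hR)) hp
  have h2 := nonpos_of_isHyperbolicHarmonic (hv.sub hu)
    (fun q hq => by simpa using (hbd q hq).neg)
    (fun q hq hR => (le_abs_self _).trans ((abs_sub_comm _ _).trans_le (hinf q hq hR))) hp
  linarith

/-! ### Differentiation under the integral sign with a compact parameter set. -/

section ParametricIntegral

open MeasureTheory

variable {G Y : Type} [TopologicalSpace Y] [MeasurableSpace Y] [BorelSpace Y]
  [SecondCountableTopology Y] [NormedAddCommGroup G] [NormedSpace ℝ G] {g : Y → ℝ} {μ : Measure Y}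

section

variable {E E' : Type} [TopologicalSpace E] [TopologicalSpace E']
  {W : Set (E × E')} {U : Set E} {K : Set E'} {φ : Y → E'}

theorem aestronglyMeasurable_smul_comp_of_continuousOn {F : E × E' → G} (hF : ContinuousOn F W)
    (hUK : U ×ˢ K ⊆ W) (hg : Integrable g μ) (hφ : Continuous φ) (hφK : ∀ y, φ y ∈ K) {p : E}
    (hp : p ∈ U) : AEStronglyMeasurable (fun y => g y • F (p, φ y)) μ := by
  have hc : Continuous fun y => F (p, φ y) :=
    hF.comp_continuous (by fun_prop) fun y => hUK ⟨hp, hφK y⟩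
  exact hg.aestronglyMeasurable.smul hc.aestronglyMeasurable

theorem integrable_smul_comp_of_continuousOn {F : E × E' → G} (hF : ContinuousOn F W)
    (hK : IsCompact K) (hUK : U ×ˢ K ⊆ W) (hg : Integrable g μ) (hφ : Continuous φ)
    (hφK : ∀ y, φ y ∈ K) {p : E} (hp : p ∈ U) : Integrable (fun y => g y • F (p, φ y)) μ := by
  obtain ⟨C, hC⟩ := (isCompact_singleton (x := p).prod hK).exists_bound_of_continuousOn
    (hF.mono ((Set.prod_mono_left (Set.singleton_subset_iff.2 hp)).trans hUK))
  refine (hg.norm.mul_const C).mono'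
    (aestronglyMeasurable_smul_comp_of_continuousOn hF hUK hg hφ hφK hp)
    (Eventually.of_forall fun y => ?_)
  rw [norm_smul]
  exact mul_le_mul_of_nonneg_left (hC _ ⟨rfl, hφK y⟩) (norm_nonneg _)

end

variable {E E' : Type} [NormedAddCommGroup E] [NormedSpace ℝ E]
  [NormedAddCommGroup E'] [NormedSpace ℝ E']
  {W : Set (E × E')} {U : Set E} {K : Set E'} {φ : Y → E'}

/-- The partial derivative of `F` in its first variable. -/
noncomputable def partialFDeriv (F : E × E' → G) (x : E × E') : E →L[ℝ] G :=
  (fderiv ℝ F x).comp (ContinuousLinearMap.inl ℝ E E')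

theorem ContDiffOn.partialFDeriv {F : E × E' → G} (hW : IsOpen W) (hF : ContDiffOn ℝ ∞ F W) :
    ContDiffOn ℝ ∞ (partialFDeriv F) W :=
  (hF.fderiv_of_isOpen hW (by simp)).clm_comp contDiffOn_const

theorem hasFDerivAt_partialFDeriv {F : E × E' → G} (hW : IsOpen W) (hF : ContDiffOn ℝ ∞ F W)
    {p : E} {ζ : E'} (h : (p, ζ) ∈ W) :
    HasFDerivAt (fun q => F (q, ζ)) (partialFDeriv F (p, ζ)) p :=
  ((hF.contDiffAt (hW.mem_nhds h)).differentiableAt (by simp)).hasFDerivAt.comp p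
    (hasFDerivAt_prodMk_left p ζ)

/-- The integration variable enters `F` only through the compact set `K`, so the partial derivative
is bounded on a closed ball times `K`, and a multiple of `‖g‖` dominates. -/
theorem hasFDerivAt_integral_of_contDiffOn [FiniteDimensional ℝ E] {F : E × E' → G} (hF : ContDiffOn ℝ ∞ F W)
    (hW : IsOpen W) (hU : IsOpen U) (hK : IsCompact K) (hUK : U ×ˢ K ⊆ W) (hg : Integrable g μ)
    (hφ : Continuous φ) (hφK : ∀ y, φ y ∈ K) {p : E} (hp : p ∈ U) :
    HasFDerivAt (fun p => ∫ y, g y • F (p, φ y) ∂μ) (∫ y, g y • partialFDeriv F (p, φ y) ∂μ) p := by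
  have hF' := (hF.partialFDeriv hW).continuousOn
  obtain ⟨r, hr, hrU⟩ := Metric.nhds_basis_closedBall.mem_iff.1 (hU.mem_nhds hp)
  obtain ⟨C, hC⟩ := ((isCompact_closedBall p r).prod hK).exists_bound_of_continuousOn
    (hF'.mono ((Set.prod_mono_left hrU).trans hUK))
  refine hasFDerivAt_integral_of_dominated_of_fderiv_le (bound := fun y => ‖g y‖ * C)
    (F' := fun p y => g y • partialFDeriv F (p, φ y))
    (Metric.closedBall_mem_nhds p hr) ?_
    (integrable_smul_comp_of_continuousOn hF.continuousOn hK hUK hg hφ hφK hp)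
    (aestronglyMeasurable_smul_comp_of_continuousOn hF' hUK hg hφ hφK hp)
    (Eventually.of_forall fun y q hq => ?_) (hg.norm.mul_const C)
    (Eventually.of_forall fun y q hq => ?_)
  · filter_upwards [hU.mem_nhds hp] with q hq
    exact aestronglyMeasurable_smul_comp_of_continuousOn hF.continuousOn hUK hg hφ hφK hq
  · rw [norm_smul]
    exact mul_le_mul_of_nonneg_left (hC _ ⟨hq, hφK y⟩) (norm_nonneg _)
  · exact (hasFDerivAt_partialFDeriv hW hF (hUK ⟨hrU hq, hφK y⟩)).const_smul (g y)

theorem contDiffOn_integral_of_contDiffOn [FiniteDimensional ℝ E] (hW : IsOpen W) (hU : IsOpen U) (hK : IsCompact K)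
    (hUK : U ×ˢ K ⊆ W) (hg : Integrable g μ) (hφ : Continuous φ) (hφK : ∀ y, φ y ∈ K)
    {F : E × E' → G} (hF : ContDiffOn ℝ ∞ F W) :
    ContDiffOn ℝ ∞ (fun p => ∫ y, g y • F (p, φ y) ∂μ) U := by
  rw [contDiffOn_infty]
  intro n
  -- The derivative is an integral of the same shape with values in `E →L[ℝ] G`, so the target space
  -- has to vary.
  induction n generalizing G with
  | zero =>
    exact contDiffOn_zero.2 fun p hp => (hasFDerivAt_integral_of_contDiffOn hF hW hU hK hUK hg
      hφ hφK hp).continuousAt.continuousWithinAt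
  | succ n ih =>
    push_cast
    rw [contDiffOn_succ_iff_fderiv_of_isOpen hU]
    refine ⟨fun p hp => (hasFDerivAt_integral_of_contDiffOn hF hW hU hK hUK hg
      hφ hφK hp).differentiableAt.differentiableWithinAt, by simp, ?_⟩
    exact (ih (hF.partialFDeriv hW)).congr fun p hp =>
      (hasFDerivAt_integral_of_contDiffOn hF hW hU hK hUK hg hφ hφK hp).fderiv

theorem fderiv_integral_apply_of_contDiffOn [FiniteDimensional ℝ E] {F : E × E' → G} (hF : ContDiffOn ℝ ∞ F W)
    (hW : IsOpen W) (hU : IsOpen U) (hK : IsCompact K) (hUK : U ×ˢ K ⊆ W) (hg : Integrable g μ)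
    (hφ : Continuous φ) (hφK : ∀ y, φ y ∈ K) {p : E} (hp : p ∈ U) (v : E) :
    fderiv ℝ (fun p => ∫ y, g y • F (p, φ y) ∂μ) p v =
      ∫ y, g y • partialFDeriv F (p, φ y) v ∂μ := by
  rw [(hasFDerivAt_integral_of_contDiffOn hF hW hU hK hUK hg hφ hφK hp).fderiv,
    ContinuousLinearMap.integral_apply (integrable_smul_comp_of_continuousOn
      (hF.partialFDeriv hW).continuousOn hK hUK hg hφ hφK hp)]
  rfl

variable {W : Set (E3 × E')} {U : Set E3}

theorem hyperbolicLaplacian_integral {F : E3 × E' → ℝ} (hF : ContDiffOn ℝ ∞ F W)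
    (hW : IsOpen W) (hU : IsOpen U) (hK : IsCompact K) (hUK : U ×ˢ K ⊆ W) (hg : Integrable g μ)
    (hφ : Continuous φ) (hφK : ∀ y, φ y ∈ K) {p : E3} (hp : p ∈ U) :
    hyperbolicLaplacian (fun p => ∫ y, g y • F (p, φ y) ∂μ) p =
      ∫ y, g y • hyperbolicLaplacian (fun q => F (q, φ y)) p ∂μ := by
  let e (i : Fin 3) : E3 := EuclideanSpace.single i 1
  let F₁ (v : E3) (x : E3 × E') : ℝ := partialFDeriv F x v
  let F₂ (v : E3) (x : E3 × E') : ℝ := partialFDeriv (F₁ v) x v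
  have hF₁ (v : E3) : ContDiffOn ℝ ∞ (F₁ v) W := (hF.partialFDeriv hW).clm_apply contDiffOn_const
  have hF₂ (v : E3) : ContDiffOn ℝ ∞ (F₂ v) W :=
    ((hF₁ v).partialFDeriv hW).clm_apply contDiffOn_const
  have hint₁ (v : E3) : Integrable (fun y => g y • F₁ v (p, φ y)) μ :=
    integrable_smul_comp_of_continuousOn (hF₁ v).continuousOn hK hUK hg hφ hφK hp
  have hint₂ (v : E3) : Integrable (fun y => g y • F₂ v (p, φ y)) μ :=
    integrable_smul_comp_of_continuousOn (hF₂ v).continuousOn hK hUK hg hφ hφK hp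
  -- Used twice, for the integral and for the integrand at fixed `y`.
  have hsum {u : E3 → ℝ} {u₁ u₂ : E3 → E3 → ℝ} (hu : ContDiffAt ℝ 2 u p)
      (h₁ : ∀ v, ∀ᶠ q in 𝓝 p, fderiv ℝ u q v = u₁ v q)
      (h₂ : ∀ v, fderiv ℝ (u₁ v) p v = u₂ v p) :
      hyperbolicLaplacian u p = -(p 0) ^ 2 * (u₂ (e 0) p + u₂ (e 1) p + u₂ (e 2) p) +
        p 0 * u₁ (e 0) p := by
    have h₃ (i : Fin 3) : fderiv ℝ (fun q => fderiv ℝ u q (EuclideanSpace.single i 1)) p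
        (EuclideanSpace.single i 1) = u₂ (e i) p := by
      rw [EventuallyEq.fderiv_eq (h₁ (e i)), h₂]
    rw [hyperbolicLaplacian, laplacian_eq_sum_fderiv hu, Fin.sum_univ_three, h₃, h₃, h₃,
      (h₁ (e 0)).self_of_nhds]
  have hright (y : Y) : hyperbolicLaplacian (fun q => F (q, φ y)) p =
      -(p 0) ^ 2 * (F₂ (e 0) (p, φ y) + F₂ (e 1) (p, φ y) + F₂ (e 2) (p, φ y)) +
        p 0 * F₁ (e 0) (p, φ y) := by
    have hmem {q : E3} (hq : q ∈ U) : (q, φ y) ∈ W := hUK ⟨hq, hφK y⟩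
    refine hsum (u₁ := fun v q => F₁ v (q, φ y)) (u₂ := fun v q => F₂ v (q, φ y)) ?_
      (fun v => ?_) (fun v => ?_)
    · exact ((hF.contDiffAt (hW.mem_nhds (hmem hp))).of_le ENat.LEInfty.out).comp p
        (contDiffAt_id.prodMk contDiffAt_const)
    · filter_upwards [hU.mem_nhds hp] with q hq
      rw [(hasFDerivAt_partialFDeriv hW hF (hmem hq)).fderiv]
    · rw [(hasFDerivAt_partialFDeriv hW (hF₁ v) (hmem hp)).fderiv]
  rw [hsum (u₁ := fun v q => ∫ y, g y • F₁ v (q, φ y) ∂μ)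
    (u₂ := fun v q => ∫ y, g y • F₂ v (q, φ y) ∂μ)]
  · have h₁ : Integrable (fun y => -(p 0) ^ 2 * (g y • F₂ (e 0) (p, φ y) +
        g y • F₂ (e 1) (p, φ y) + g y • F₂ (e 2) (p, φ y))) μ :=
      (((hint₂ _).add (hint₂ _)).add (hint₂ _)).const_mul _
    have h₂ : Integrable (fun y => g y • F₂ (e 0) (p, φ y) + g y • F₂ (e 1) (p, φ y)) μ :=
      (hint₂ _).add (hint₂ _)
    rw [← integral_add (hint₂ _) (hint₂ _), ← integral_add h₂ (hint₂ _),
      ← integral_const_mul, ← integral_const_mul, ← integral_add h₁ ((hint₁ _).const_mul _)]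
    refine integral_congr_ae (Eventually.of_forall fun y => ?_)
    simp only [hright, smul_eq_mul]
    ring
  · exact ((contDiffOn_integral_of_contDiffOn hW hU hK hUK hg hφ hφK hF).contDiffAt
      (hU.mem_nhds hp)).of_le ENat.LEInfty.out
  · intro v
    filter_upwards [hU.mem_nhds hp] with q hq
    exact fderiv_integral_apply_of_contDiffOn hF hW hU hK hUK hg hφ hφK hq v
  · intro v
    exact fderiv_integral_apply_of_contDiffOn (hF₁ v) hW hU hK hUK hg hφ hφK hp v

end ParametricIntegral

/-! ### The boundary plane inside the sphere at infinity. -/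

/-- The boundary plane `z = 0`, with coordinates `(x₂, x₃)`. -/
abbrev BoundaryPlane : Type := EuclideanSpace ℝ (Fin 2)

/-- The vertical projection to the boundary plane. -/
noncomputable def toBoundaryPlane (p : E3) : BoundaryPlane := !₂[p 1, p 2]

theorem contDiff_toBoundaryPlane : ContDiff ℝ ∞ toBoundaryPlane := by
  rw [contDiff_euclidean]
  intro i
  fin_cases i <;> simp [toBoundaryPlane] <;> fun_prop

/-- The usual distance distortion of a Möbius map. As `D ≥ 1` on the boundary plane, it makes
`boundaryPoint` Lipschitz with constant 2. -/
theorem norm_sq_toBall_sub_toBall {p q : E3} (hp : 0 < ballDenom p) (hq : 0 < ballDenom q) :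
    ‖toBall p - toBall q‖ ^ 2 = 4 * ‖p - q‖ ^ 2 / (ballDenom p * ballDenom q) := by
  rw [EuclideanSpace.norm_sq_eq, EuclideanSpace.norm_sq_eq, Fin.sum_univ_three, Fin.sum_univ_three]
  simp only [toBall, Real.norm_eq_abs, sq_abs]
  simp only [PiLp.sub_apply, Matrix.cons_val]
  have hp' := hp.ne'
  have hq' := hq.ne'
  unfold ballDenom at hp' hq' ⊢
  field_simp
  ring

/-- Neighbourhoods of `∞` are thus described by large `ballDenom`. -/
theorem norm_sq_toBall_sub_infinity {p : E3} (hp : 0 < ballDenom p) :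
    ‖toBall p - EuclideanSpace.single 0 1‖ ^ 2 = 4 / ballDenom p := by
  rw [EuclideanSpace.norm_sq_eq, Fin.sum_univ_three]
  simp only [toBall, Real.norm_eq_abs, sq_abs]
  simp
  have hp' := hp.ne'
  unfold ballDenom at hp' ⊢
  field_simp
  ring

theorem norm_boundaryPoint_sub_le (x y : BoundaryPlane) :
    ‖(boundaryPoint (x 0) (x 1) : E3) - boundaryPoint (y 0) (y 1)‖ ≤ 2 * ‖x - y‖ := by
  have hD (a b : ℝ) : 1 ≤ ballDenom !₂[0, a, b] := by
    have : 0 ≤ a ^ 2 + b ^ 2 := by positivity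
    simpa [ballDenom, add_assoc] using this
  have h := norm_sq_toBall_sub_toBall (zero_lt_one.trans_le (hD (x 0) (x 1)))
    (zero_lt_one.trans_le (hD (y 0) (y 1)))
  have h1 : ‖(!₂[0, x 0, x 1] : E3) - !₂[0, y 0, y 1]‖ ^ 2 = ‖x - y‖ ^ 2 := by
    simp [EuclideanSpace.norm_sq_eq, Fin.sum_univ_three]
  have h2 := one_le_mul_of_one_le_of_one_le (hD (x 0) (x 1)) (hD (y 0) (y 1))
  rw [h1] at h
  refine abs_le_of_sq_le_sq' ?_ (by positivity) |>.2
  change ‖toBall !₂[0, x 0, x 1] - toBall !₂[0, y 0, y 1]‖ ^ 2 ≤ _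
  rw [h, mul_pow]
  norm_num
  exact div_le_self (by positivity) h2

theorem contDiff_toBall_boundaryPlane :
    ContDiff ℝ ∞ fun y : BoundaryPlane => toBall !₂[0, y 0, y 1] := by
  rw [contDiff_euclidean]
  have h (y : BoundaryPlane) : (0 + 1) ^ 2 + (y 0) ^ 2 + (y 1) ^ 2 ≠ 0 := by positivity
  intro i
  fin_cases i <;> simp [toBall] <;> refine ContDiff.div (by fun_prop) (by fun_prop) ?_ <;>
    simpa using h

theorem ContMDiff.codRestrict_sphereAtInfinity {H N F : Type} [NormedAddCommGroup F]
    [NormedSpace ℝ F] [TopologicalSpace H] {I : ModelWithCorners ℝ F H} [TopologicalSpace N]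
    [ChartedSpace H N] {n : ℕ∞ω} [IsManifold I n N] {f : N → E3} (hf : ContMDiff I 𝓘(ℝ, E3) n f)
    (hf' : ∀ x, f x ∈ Metric.sphere (0 : E3) 1) :
    ContMDiff I (𝓡 2) n (Set.codRestrict f _ hf' : N → SphereAtInfinity) :=
  haveI : Fact (Module.finrank ℝ E3 = 2 + 1) := ⟨by simp⟩
  hf.codRestrict_sphere hf'

theorem contMDiff_boundaryPoint : ContMDiff 𝓘(ℝ, BoundaryPlane) (𝓡 2) ∞
    fun y : BoundaryPlane => boundaryPoint (y 0) (y 1) :=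
  contDiff_toBall_boundaryPlane.contMDiff.codRestrict_sphereAtInfinity
    fun y => (boundaryPoint (y 0) (y 1)).2

/-- A smooth function on the sphere is Lipschitz continuous. -/
theorem ContMDiff.exists_lipschitzWith {f : SphereAtInfinity → ℝ}
    (hf : ContMDiff (𝓡 2) 𝓘(ℝ, ℝ) 1 f) : ∃ K, LipschitzWith K f := by
  have hmem {x : E3} (hx : x ≠ 0) : ‖x‖⁻¹ • x ∈ Metric.sphere (0 : E3) 1 := by
    rw [mem_sphere_zero_iff_norm, norm_smul, norm_inv, norm_norm,
      inv_mul_cancel₀ (norm_ne_zero_iff.2 hx)]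
  let V : TopologicalSpace.Opens E3 := ⟨{0}ᶜ, isOpen_compl_singleton⟩
  classical
  -- The extension of `f` that is constant on rays is `C¹` off the origin, hence locally Lipschitz;
  -- compactness of the sphere makes the constant global.
  let g : E3 → ℝ := fun x => if hx : x ≠ 0 then f ⟨‖x‖⁻¹ • x, hmem hx⟩ else 0
  have hg {x : E3} (hx : x ≠ 0) : ContDiffAt ℝ 1 g x := by
    rw [← contMDiffAt_iff_contDiffAt]
    have h1 : ContMDiff 𝓘(ℝ, E3) 𝓘(ℝ, E3) 1 fun x : V => ‖(x : E3)‖⁻¹ • (x : E3) := by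
      intro y
      refine contMDiffAt_subtype_iff (f := fun y : E3 => ‖y‖⁻¹ • y).2 ?_
      have hy : (y : E3) ≠ 0 := y.2
      exact (((contDiffAt_norm ℝ hy).inv (norm_ne_zero_iff.2 hy)).smul contDiffAt_id).contMDiffAt
    have h2 := hf.comp (h1.codRestrict_sphereAtInfinity fun y => hmem y.2)
    refine contMDiffAt_subtype_iff (U := V) (x := ⟨x, hx⟩).1 ?_
    have h3 : (fun y : V => g y) = f ∘ Set.codRestrict (fun x : V => ‖(x : E3)‖⁻¹ • (x : E3))
        (Metric.sphere (0 : E3) 1) (fun y => hmem y.2) := by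
      funext y
      have hy : (y : E3) ≠ 0 := y.2
      simp only [g, hy, ne_eq, not_false_eq_true, dif_pos]
      rfl
    rw [h3]
    exact h2.contMDiffAt
  have hloc : LocallyLipschitzOn (Metric.sphere (0 : E3) 1) g := by
    intro x hx
    obtain ⟨K, t, ht, hK⟩ := (hg (ne_zero_of_mem_unit_sphere ⟨x, hx⟩)).exists_lipschitzOnWith
    exact ⟨K, t, mem_nhdsWithin_of_mem_nhds ht, hK⟩
  obtain ⟨K, hK⟩ := hloc.exists_lipschitzOnWith_of_compact (isCompact_sphere _ _)
  refine ⟨K, fun x y => ?_⟩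
  have hgf (x : SphereAtInfinity) : g x = f x := by
    have hx : (x : E3) ≠ 0 := ne_zero_of_mem_unit_sphere x
    simp only [g, hx, ne_eq, not_false_eq_true, dif_pos]
    congr 1
    ext1
    simp
  rw [← hgf, ← hgf]
  exact hK x.2 y.2

/-! ### The Poisson integral: boundary estimate, smoothness, harmonicity. -/

section PoissonIntegral

open MeasureTheory

/-- The (unnormalised) Poisson kernel of the point `(1, 0, 0)`. -/
noncomputable def poissonWeight (y : BoundaryPlane) : ℝ := ((1 + ‖y‖ ^ 2) ^ 2)⁻¹

theorem poissonWeight_pos (y : BoundaryPlane) : 0 < poissonWeight y := by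
  unfold poissonWeight
  positivity

theorem integrable_poissonWeight : Integrable poissonWeight := by
  have h := integrable_rpow_neg_one_add_norm_sq (E := BoundaryPlane) (μ := volume) (r := 4)
    (by simp; norm_num)
  refine h.congr (Eventually.of_forall fun y => ?_)
  have : (-4 / 2 : ℝ) = -((2 : ℕ) : ℝ) := by norm_num
  simp only [poissonWeight, this]
  rw [Real.rpow_neg (by positivity), Real.rpow_natCast]

/-- The integrand is at most `(1 + |y|²)^(-3/2)`, of order `|y|⁻³`, integrable in dimension 2. -/
theorem integrable_poissonWeight_mul_norm : Integrable fun y => poissonWeight y * ‖y‖ := by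
  have h := integrable_rpow_neg_one_add_norm_sq (E := BoundaryPlane) (μ := volume) (r := 3)
    (by simp; norm_num)
  refine h.mono' (integrable_poissonWeight.aestronglyMeasurable.mul (by fun_prop))
    (Eventually.of_forall fun y => ?_)
  have h0 : 0 < 1 + ‖y‖ ^ 2 := by positivity
  rw [Real.norm_of_nonneg (mul_nonneg (poissonWeight_pos y).le (norm_nonneg y)),
    show (-3 / 2 : ℝ) = -((2 : ℕ) : ℝ) + 1 / 2 by norm_num, Real.rpow_add h0,
    Real.rpow_neg h0.le, Real.rpow_natCast, ← Real.sqrt_eq_rpow]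
  exact mul_le_mul_of_nonneg_left (Real.le_sqrt_of_sq_le (by linarith)) (poissonWeight_pos y).le

theorem integral_poissonWeight_pos : 0 < ∫ y, poissonWeight y := by
  rw [integral_pos_iff_support_of_nonneg (fun y => (poissonWeight_pos y).le)
    integrable_poissonWeight]
  have : Function.support poissonWeight = Set.univ :=
    Set.eq_univ_of_forall fun y => (poissonWeight_pos y).ne'
  simp [this]

/-- The (unnormalised) Poisson integral of a function on the boundary plane. -/
noncomputable def poissonIntegral (f : BoundaryPlane → ℝ) (p : E3) : ℝ :=
  ∫ y, hyperbolicPoissonKernel y p * f y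

/-- Substitute `y = x + z s`: the Jacobian `z²` cancels the scaling of the kernel, leaving a weight
independent of `p`. -/
theorem poissonIntegral_eq (f : BoundaryPlane → ℝ) {p : E3} (hp : p ∈ hyperbolicSpace) :
    poissonIntegral f p = ∫ s, poissonWeight s * f (toBoundaryPlane p + p 0 • s) := by
  have hz : 0 < p 0 := hp
  rw [poissonIntegral, ← integral_add_left_eq_self _ (toBoundaryPlane p)]
  have h := Measure.integral_comp_smul (volume : Measure BoundaryPlane)
    (fun y => hyperbolicPoissonKernel (toBoundaryPlane p + y) p * f (toBoundaryPlane p + y)) (p 0)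
  rw [finrank_euclideanSpace_fin, abs_of_pos (by positivity), smul_eq_mul,
    eq_inv_mul_iff_mul_eq₀ (by positivity), ← integral_const_mul] at h
  rw [← h]
  refine integral_congr_ae (Eventually.of_forall fun s => ?_)
  have h1 : ‖s‖ ^ 2 = s 0 ^ 2 + s 1 ^ 2 := by simp [EuclideanSpace.norm_sq_eq]
  have h2 : 0 < 1 + s 0 ^ 2 + s 1 ^ 2 := by positivity
  simp only [poissonWeight, hyperbolicPoissonKernel, toBoundaryPlane, h1]
  simp
  field_simp
  ring

variable {f : BoundaryPlane → ℝ} {M : ℝ}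

theorem integrable_poissonWeight_mul (hf : Continuous f) (hM : ∀ y, |f y| ≤ M) :
    Integrable fun y => poissonWeight y * f y :=
  integrable_poissonWeight.mul_bdd (c := M) hf.aestronglyMeasurable (Eventually.of_forall hM)

theorem abs_poissonIntegral_le (hM : ∀ y, |f y| ≤ M) {p : E3}
    (hp : p ∈ hyperbolicSpace) : |poissonIntegral f p| ≤ (∫ y, poissonWeight y) * M := by
  rw [poissonIntegral_eq f hp, ← integral_mul_const]
  rw [← Real.norm_eq_abs]
  refine norm_integral_le_of_norm_le (integrable_poissonWeight.mul_const M)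
    (Eventually.of_forall fun s => ?_)
  rw [norm_mul, Real.norm_of_nonneg (poissonWeight_pos s).le]
  exact mul_le_mul_of_nonneg_left (hM _) (poissonWeight_pos s).le

/-- The central estimate: after the substitution, the Lipschitz bound gives `|f (x + z s) - f x| ≤ L
z |s|`, and one power of `z` comes out of the integral. -/
theorem abs_poissonIntegral_sub_le {L : ℝ} (hf : Continuous f) (hM : ∀ y, |f y| ≤ M)
    (hL : ∀ x y, |f x - f y| ≤ L * ‖x - y‖) {p : E3} (hp : p ∈ hyperbolicSpace) :
    |poissonIntegral f p - (∫ y, poissonWeight y) * f (toBoundaryPlane p)| ≤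
      L * (∫ s, poissonWeight s * ‖s‖) * p 0 := by
  have hz : 0 < p 0 := hp
  have h1 : Integrable fun s => poissonWeight s * f (toBoundaryPlane p + p 0 • s) :=
    integrable_poissonWeight_mul (f := fun s => f (toBoundaryPlane p + p 0 • s)) (by fun_prop)
      fun s => hM _
  rw [poissonIntegral_eq f hp, ← integral_mul_const,
    ← integral_sub h1 (integrable_poissonWeight.mul_const _), ← integral_const_mul,
    ← integral_mul_const]
  rw [← Real.norm_eq_abs]
  refine norm_integral_le_of_norm_le
    ((integrable_poissonWeight_mul_norm.const_mul L).mul_const (p 0))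
    (Eventually.of_forall fun s => ?_)
  rw [← mul_sub, norm_mul, Real.norm_of_nonneg (poissonWeight_pos s).le, Real.norm_eq_abs]
  have h2 := hL (toBoundaryPlane p + p 0 • s) (toBoundaryPlane p)
  rw [add_sub_cancel_left, norm_smul, Real.norm_of_nonneg hz.le] at h2
  calc _ ≤ poissonWeight s * (L * (p 0 * ‖s‖)) :=
        mul_le_mul_of_nonneg_left h2 (poissonWeight_pos s).le
    _ = _ := by ring

/-- The quotient `|p - y|² / (1 + |y|²)` in terms of the point `ζ` of the sphere at infinity that
corresponds to the point `y` of the boundary plane. -/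
noncomputable def sphereDistSq (x : E3 × E3) : ℝ :=
  (x.1 0 ^ 2 + x.1 1 ^ 2 + x.1 2 ^ 2) * (1 - x.2 0) / 2 - x.1 1 * x.2 1 - x.1 2 * x.2 2 +
    (1 + x.2 0) / 2

theorem sphereDistSq_pos {p ζ : E3} (hp : p ∈ hyperbolicSpace)
    (hζ : ζ ∈ Metric.sphere (0 : E3) 1) : 0 < sphereDistSq (p, ζ) := by
  have hz : 0 < p 0 := hp
  have h1 : ζ 0 ^ 2 + ζ 1 ^ 2 + ζ 2 ^ 2 = 1 := by
    have h := EuclideanSpace.norm_sq_eq ζ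
    rw [mem_sphere_zero_iff_norm.1 hζ, Fin.sum_univ_three] at h
    simpa using h.symm
  rcases eq_or_ne (ζ 0) 1 with h0 | h0
  · have h2 : ζ 1 = 0 := by nlinarith [sq_nonneg (ζ 1), sq_nonneg (ζ 2)]
    have h3 : ζ 2 = 0 := by nlinarith [sq_nonneg (ζ 1), sq_nonneg (ζ 2)]
    simp [sphereDistSq, h0, h2, h3]
  · have h2 : 0 < 1 - ζ 0 := by
      have : ζ 0 ≤ 1 := by nlinarith [sq_nonneg (ζ 1), sq_nonneg (ζ 2)]
      exact sub_pos.2 (lt_of_le_of_ne this h0)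
    -- Stereographic projection sends `ζ` to `(ζ 1, ζ 2) / (1 - ζ 0)`; this is the squared distance
    -- from `p` to that point, times `(1 - ζ 0)²`.
    have h3 : 2 * (1 - ζ 0) * sphereDistSq (p, ζ) = (1 - ζ 0) ^ 2 * p 0 ^ 2 +
        ((1 - ζ 0) * p 1 - ζ 1) ^ 2 + ((1 - ζ 0) * p 2 - ζ 2) ^ 2 := by
      simp only [sphereDistSq]
      linear_combination -h1
    have h4 : 0 < 2 * (1 - ζ 0) * sphereDistSq (p, ζ) := by
      rw [h3]
      positivity
    exact pos_of_mul_pos_right h4 (by linarith)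

theorem hyperbolicPoissonKernel_eq (y : BoundaryPlane) (p : E3) :
    hyperbolicPoissonKernel y p =
      poissonWeight y * (p 0 ^ 2 / sphereDistSq (p, toBall !₂[0, y 0, y 1]) ^ 2) := by
  have h1 : ‖y‖ ^ 2 = y 0 ^ 2 + y 1 ^ 2 := by simp [EuclideanSpace.norm_sq_eq]
  have h2 : 0 < 1 + y 0 ^ 2 + y 1 ^ 2 := by positivity
  have h3 : sphereDistSq (p, toBall !₂[0, y 0, y 1]) =
      (p 0 ^ 2 + (p 1 - y 0) ^ 2 + (p 2 - y 1) ^ 2) / (1 + y 0 ^ 2 + y 1 ^ 2) := by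
    simp [sphereDistSq, toBall]
    field_simp
    ring
  rw [h3, poissonWeight, h1, hyperbolicPoissonKernel, div_pow, div_div_eq_mul_div, ← add_assoc]
  field_simp

/-- With the integrable weight split off, the rest of the kernel is smooth near `hyperbolicSpace`
times the whole sphere, including `∞`. So the compact-parameter lemmas apply although `y` ranges
over an unbounded plane. -/
theorem contDiffOn_poissonIntegral_and_hyperbolicLaplacian (hf : Continuous f)
    (hM : ∀ y, |f y| ≤ M) : ContDiffOn ℝ ∞ (poissonIntegral f) hyperbolicSpace ∧
      ∀ p ∈ hyperbolicSpace, hyperbolicLaplacian (poissonIntegral f) p = 0 := by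
  let F : E3 × E3 → ℝ := fun x => x.1 0 ^ 2 / sphereDistSq x ^ 2
  let φ : BoundaryPlane → E3 := fun y => toBall !₂[0, y 0, y 1]
  have hcd : ContDiff ℝ ∞ sphereDistSq := by
    unfold sphereDistSq
    fun_prop
  have hW : IsOpen {x : E3 × E3 | 0 < sphereDistSq x} :=
    isOpen_lt continuous_const hcd.continuous
  have hF : ContDiffOn ℝ ∞ F {x | 0 < sphereDistSq x} :=
    ContDiffOn.div (by fun_prop) (by fun_prop) fun x hx => pow_ne_zero 2 (ne_of_gt hx)
  have hUK : hyperbolicSpace ×ˢ Metric.sphere (0 : E3) 1 ⊆ {x | 0 < sphereDistSq x} :=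
    fun x hx => sphereDistSq_pos hx.1 hx.2
  have hK : IsCompact (Metric.sphere (0 : E3) 1) := isCompact_sphere _ _
  have hφ : Continuous φ := contDiff_toBall_boundaryPlane.continuous
  have hφK (y : BoundaryPlane) : φ y ∈ Metric.sphere (0 : E3) 1 := (boundaryPoint (y 0) (y 1)).2
  have hg := integrable_poissonWeight_mul hf hM
  have heq : poissonIntegral f = fun p => ∫ y, (poissonWeight y * f y) • F (p, φ y) := by
    funext p
    refine integral_congr_ae (Eventually.of_forall fun y => ?_)
    simp only [hyperbolicPoissonKernel_eq, F, φ, smul_eq_mul]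
    ring
  rw [heq]
  refine ⟨contDiffOn_integral_of_contDiffOn hW isOpen_hyperbolicSpace hK hUK hg hφ hφK hF,
    fun p hp => ?_⟩
  rw [hyperbolicLaplacian_integral hF hW isOpen_hyperbolicSpace hK hUK hg hφ hφK hp]
  refine integral_eq_zero_of_ae (Eventually.of_forall fun y => ?_)
  have h1 : (fun q => F (q, φ y)) = fun q => (poissonWeight y)⁻¹ * hyperbolicPoissonKernel y q := by
    funext q
    rw [hyperbolicPoissonKernel_eq, inv_mul_cancel_left₀ (poissonWeight_pos y).ne']
  simp only [h1, hyperbolicLaplacian_const_mul _ (contDiffAt_hyperbolicPoissonKernel y hp),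
    hyperbolicLaplacian_hyperbolicPoissonKernel y hp, mul_zero, smul_zero, Pi.zero_apply]

end PoissonIntegral

/-! ### Boundary values, the Poisson representation and the conclusion. -/

theorem HasBoundaryValues.tendsto_of_z_eq_zero {u : E3 → ℝ} {f : SphereAtInfinity → ℝ}
    (hu : HasBoundaryValues u f) {p : E3} (hp : p 0 = 0) :
    Tendsto u (𝓝[hyperbolicSpace] p) (𝓝 (f (boundaryPoint (p 1) (p 2)))) := by
  refine (hu (boundaryPoint (p 1) (p 2))).mono_left (inf_le_inf_right _ ?_)
  have hpt : (boundaryPoint (p 1) (p 2) : E3) = toBall p := by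
    have : p = !₂[0, p 1, p 2] := by
      ext i
      fin_cases i <;> simp [hp]
    simp only [boundaryPoint]
    rw [← this]
  have hcont : ContinuousAt toBall p := by
    have hD : (p 0 + 1) ^ 2 + (p 1) ^ 2 + (p 2) ^ 2 ≠ 0 := by
      rw [hp]
      positivity
    have h : ContDiffAt ℝ 0 toBall p := by
      rw [contDiffAt_euclidean]
      intro i
      fin_cases i <;> simp only [toBall] <;> exact ContDiffAt.div (by fun_prop) (by fun_prop) hD
    exact h.continuousAt
  rw [hpt]
  exact hcont.tendsto.le_comap

theorem HasBoundaryValues.exists_bound {u : E3 → ℝ} {f : SphereAtInfinity → ℝ}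
    (hu : HasBoundaryValues u f) :
    ∃ R M : ℝ, ∀ p ∈ hyperbolicSpace, R ≤ ballDenom p → |u p| ≤ M := by
  let ζ : SphereAtInfinity := ⟨EuclideanSpace.single 0 1, by simp⟩
  have h := (hu ζ).eventually (Metric.ball_mem_nhds (f ζ) one_pos)
  rw [eventually_inf_principal, eventually_comap] at h
  obtain ⟨δ, hδ, hball⟩ := Metric.eventually_nhds_iff.1 h
  -- The squared distance to `∞` in the ball is `4 / D`; the `+ 1` makes it strictly less than `δ²`.
  refine ⟨4 / δ ^ 2 + 1, |f ζ| + 1, fun p hp hR => ?_⟩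
  have hD := one_lt_ballDenom hp
  have hclose : dist (toBall p) ζ < δ := by
    rw [dist_eq_norm]
    refine lt_of_pow_lt_pow_left₀ 2 hδ.le ?_
    rw [norm_sq_toBall_sub_infinity (by linarith), div_lt_iff₀ (by linarith), mul_comm,
      ← div_lt_iff₀ (by positivity)]
    linarith
  have h1 : |u p - f ζ| < 1 := hball hclose p rfl hp
  have h2 := abs_sub_abs_le_abs_sub (u p) (f ζ)
  linarith

/-- Both sides have boundary values `f` on the plane and are bounded near `∞`, so the maximum
principle applies without comparing their limits at `∞`. -/
theorem eqOn_poissonIntegral {u : E3 → ℝ} (hu : IsHyperbolicHarmonic u)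
    {f : BoundaryPlane → ℝ} {L M R M' : ℝ} (hf : Continuous f) (hM : ∀ y, |f y| ≤ M)
    (hL : ∀ x y, |f x - f y| ≤ L * ‖x - y‖)
    (hbd : ∀ p : E3, p 0 = 0 → Tendsto u (𝓝[hyperbolicSpace] p) (𝓝 (f (toBoundaryPlane p))))
    (hinf : ∀ p ∈ hyperbolicSpace, R ≤ ballDenom p → |u p| ≤ M') :
    Set.EqOn u (fun p => (∫ y, poissonWeight y)⁻¹ * poissonIntegral f p) hyperbolicSpace := by
  have hc := integral_poissonWeight_pos
  obtain ⟨hsmooth, hharm⟩ := contDiffOn_poissonIntegral_and_hyperbolicLaplacian hf hM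
  have hP : IsHyperbolicHarmonic (poissonIntegral f) :=
    ⟨hsmooth.of_le ENat.LEInfty.out, hharm⟩
  refine eqOn_of_isHyperbolicHarmonic (R := R) (M := M' + M) hu (hP.const_mul _) (fun p hp => ?_)
    fun p hp hR => ?_
  · have h1 : Tendsto (fun q => poissonIntegral f q - (∫ y, poissonWeight y) *
        f (toBoundaryPlane q)) (𝓝[hyperbolicSpace] p) (𝓝 0) := by
      refine squeeze_zero_norm' (a := fun q : E3 => L * (∫ s, poissonWeight s * ‖s‖) * q 0) ?_ ?_
      · exact eventually_mem_nhdsWithin.mono fun q hq => abs_poissonIntegral_sub_le hf hM hL hq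
      · have h : Continuous fun q : E3 => L * (∫ s, poissonWeight s * ‖s‖) * q 0 := by fun_prop
        simpa [hp] using (h.tendsto p).mono_left (nhdsWithin_le_nhds (s := hyperbolicSpace))
    have h2 : Tendsto (fun q => f (toBoundaryPlane q)) (𝓝[hyperbolicSpace] p)
        (𝓝 (f (toBoundaryPlane p))) :=
      ((hf.comp contDiff_toBoundaryPlane.continuous).tendsto p).mono_left nhdsWithin_le_nhds
    have h3 := ((hbd p hp).sub h2).sub (h1.const_mul (∫ y, poissonWeight y)⁻¹)
    simp only [sub_self, mul_zero] at h3
    refine h3.congr fun q => ?_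
    rw [mul_sub, inv_mul_cancel_left₀ hc.ne']
    ring
  · have h1 := abs_poissonIntegral_le hM hp
    have h2 : |(∫ y, poissonWeight y)⁻¹ * poissonIntegral f p| ≤ M := by
      rw [abs_mul, abs_of_pos (inv_pos.2 hc), inv_mul_le_iff₀ hc]
      exact h1
    exact (abs_sub _ _).trans (add_le_add (hinf p hp hR) h2)

theorem mainTheorem4 (β : SphereAtInfinity → ℝ)
    (hβ : ContMDiff (𝓡 2) 𝓘(ℝ, ℝ) ∞ β) (hβ0 : ∀ ζ, β ζ ≠ 0)
    (u : E3 → ℝ) (hu : IsHyperbolicHarmonic u)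
    (hub : HasBoundaryValues u (fun ζ => (β ζ)⁻¹)) :
    ∃ ε : ℝ, 0 < ε ∧ ∃ v : E3 → ℝ,
      ContDiffOn ℝ ∞ v (collar ε) ∧
      (∃ M : ℝ, ∀ p ∈ collar ε, |v p| ≤ M) ∧
      ∀ p ∈ collar ε, u p = (β (boundaryPoint (p 1) (p 2)))⁻¹ + p 0 * v p := by
  have hsph : ContMDiff (𝓡 2) 𝓘(ℝ, ℝ) ∞ fun ζ => (β ζ)⁻¹ := hβ.inv₀ hβ0
  obtain ⟨K, hK⟩ := (hsph.of_le (m := 1) ENat.LEInfty.out).exists_lipschitzWith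
  obtain ⟨M, hM⟩ := isCompact_univ.exists_bound_of_continuousOn hsph.continuous.continuousOn
  obtain ⟨R, M', hinf⟩ := hub.exists_bound
  let f : BoundaryPlane → ℝ := fun y => (β (boundaryPoint (y 0) (y 1)))⁻¹
  have hf : ContDiff ℝ ∞ f := contMDiff_iff_contDiff.1 (hsph.comp contMDiff_boundaryPoint)
  have hfM (y : BoundaryPlane) : |f y| ≤ M := hM _ trivial
  have hfL (x y : BoundaryPlane) : |f x - f y| ≤ K * 2 * ‖x - y‖ := by
    have h := hK.dist_le_mul (boundaryPoint (x 0) (x 1)) (boundaryPoint (y 0) (y 1))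
    rw [Subtype.dist_eq, dist_eq_norm, dist_eq_norm] at h
    calc |f x - f y| ≤ _ := h
      _ ≤ K * (2 * ‖x - y‖) :=
        mul_le_mul_of_nonneg_left (norm_boundaryPoint_sub_le x y) K.2
      _ = _ := by ring
  have hfp (p : E3) : (β (boundaryPoint (p 1) (p 2)))⁻¹ = f (toBoundaryPlane p) := rfl
  have heq := eqOn_poissonIntegral hu hf.continuous hfM hfL
    (fun p hp => hub.tendsto_of_z_eq_zero hp) hinf
  have hsmooth : ContDiffOn ℝ ∞ u hyperbolicSpace :=
    (contDiffOn_const.mul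
      (contDiffOn_poissonIntegral_and_hyperbolicLaplacian hf.continuous hfM).1).congr heq
  -- The choice `ε = 1` is arbitrary: the bound on the quotient holds on the whole half-space.
  refine ⟨1, one_pos, fun p => (u p - f (toBoundaryPlane p)) / p 0, ?_,
    ⟨(∫ y, poissonWeight y)⁻¹ * (K * 2 * ∫ s, poissonWeight s * ‖s‖), fun p hp => ?_⟩,
    fun p hp => ?_⟩
  · refine ContDiffOn.mono (ContDiffOn.div (hsmooth.sub ?_) (by fun_prop)
      fun p hp => ne_of_gt hp) fun p hp => hp.1
    exact (hf.comp contDiff_toBoundaryPlane).contDiffOn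
  · have hz : 0 < p 0 := hp.1
    have hc := integral_poissonWeight_pos
    have h := abs_poissonIntegral_sub_le hf.continuous hfM hfL hp.1
    rw [abs_div, abs_of_pos hz, div_le_iff₀ hz, heq hp.1, mul_assoc _ _ (p 0),
      le_inv_mul_iff₀ hc, ← abs_of_pos hc, ← abs_mul, abs_of_pos hc, mul_sub,
      mul_inv_cancel_left₀ hc.ne']
    exact h
  · have hz : p 0 ≠ 0 := ne_of_gt hp.1
    rw [hfp, mul_div_cancel₀ _ hz]
    ring
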